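/- Let the Hilbert space of $M$ qubits be $(\mathbb C^2)^{\otimes M}$ with its computational basis. A preparation scheme for $M$ qubits is a partial map $D$ from finite bit strings to (possibly mixed) states of $M$ qubits. It prepares a pure state $|\psi\rangle$ with precision $\epsilon$ from the string $p$ if $D(p)=\rho$ is defined and $\langle\psi|\rho|\psi\rangle\ge 1-\epsilon$. A function $K_Q^\epsilon$ on the pure states of $M$ qubits, with values in $\mathbb N\cup\{\infty\}$, is called a notion of quantum Kolmogorov complexity that counts the classical bits needed to prepare a pure state with precision $\epsilon$ if there is a preparation scheme $D$ in which at most $K_Q^\epsilon(|\psi\rangle)$ bits suffice to prepare $|\psi\rangle$ with precision $\epsilon$, for every pure state $|\psi\rangle$ with $K_Q^\epsilon(|\psi\rangle)<\infty$. (The smallest sufficient number of bits for a given scheme $D$ is such a notion; $D$ may depend on $M$ and need not be computable.) For $0<\Delta<1$ call $E:\{0,1\}^n\to\{0,1\}^m$ a $\Delta$-code if $E(x)$ and $E(y)$ have Hamming distance at least $(1-\Delta)m$ for all $x\ne y$. The fingerprint of $x\in\{0,1\}^n$ is the state $|h_x\rangle=\frac1{\sqrt m}\sum_{i=0}^{m-1}|i\rangle|E_i(x)\rangle$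 of $M=\lceil\log_2 m\rceil+1$ qubits, where $E_i(x)$ is the bit of $E(x)$ at position $i$ (positions numbered from $0$) and $|i\rangle$ is the computational basis state given by the binary digits of $i$. Then the following hold. 1. Let $0<\Delta<1$ and $0\le\epsilon<1-\Delta$. There are $C>0$ and $n_0$, depending only on $\Delta$ and $\epsilon$, such that for all real $c>1$, all $n\ge n_0$ and $m$ with $m=cn$, every $\Delta$-code $E:\{0,1\}^n\to\{0,1\}^m$ and every notion $K_Q^\epsilon$ as above for states of $M=\lceil\log_2 m\rceil+1$ qubits, there is an $x\in\{0,1\}^n$ such that the $M$-qubit state $|h_x\rangle$ (a unit vector) satisfies $$K_Q^\epsilon(|h_x\rangle)\ \ge\ C\,\frac{2^{M/2}}{c}.$$ 2. For every $\frac12<\Delta<1$ there is an integer $c>1$ such that for every $n$ there is a $\Delta$-code $E:\{0,1\}^n\to\{0,1\}^{cn}$. 3. For every $0\le\epsilon<1$ there are $C>0$ and $M_0$ such that for all $M\ge M_0$ and every notion $K_Q^\epsilon$ as above for states of $M$ qubits, there is a pure $M$-qubit state $|\psi\rangle$ with $K_Q^\epsilon(|\psi\rangle)\ge C\,2^{M/2}$.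 -/

import Mathlib

open scoped ENNReal ComplexOrder

noncomputable section

/-- The Hilbert space of `M` qubits, with the computational basis indexed by bit strings. -/
abbrev QubitSpace (M : ℕ) : Type := EuclideanSpace ℂ (Fin M → Bool)

/-- A (possibly mixed) state of `M` qubits, given by its density matrix. -/
structure DensityState (M : ℕ) where
  mat : Matrix (Fin M → Bool) (Fin M → Bool) ℂ
  posSemidef : mat.PosSemidef
  trace_eq_one : mat.trace = 1

/-- The fidelity `⟨ψ|ρ|ψ⟩` of the state `ρ` with the pure state `ψ`.
For `ρ = |φ⟩⟨φ|` this is `|⟨ψ|φ⟩|²`. -/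
def DensityState.fidelity {M : ℕ} (ρ : DensityState M) (ψ : QubitSpace M) : ℝ :=
  (dotProduct (star ψ.ofLp) (ρ.mat.mulVec ψ.ofLp)).re

/-- A way of specifying states of `M` qubits by classical bits: a partial map that sends
a bit string to the state which is prepared (or written down) from it. -/
abbrev PreparationScheme (M : ℕ) : Type := List Bool → Option (DensityState M)

/-- The bit string `p` allows to prepare `ψ` with precision `ε`: it specifies a state that is
`ε`-close to `ψ`. -/
def PreparationScheme.Prepares {M : ℕ} (D : PreparationScheme M) (ε : ℝ) (p : List Bool)
    (ψ : QubitSpace M) : Prop :=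
  ∃ ρ : DensityState M, D p = some ρ ∧ 1 - ε ≤ ρ.fidelity ψ

/-- The smallest number of classical bits that allows to prepare `ψ` with precision `ε` in the
scheme `D` (it is `⊤` if there is no such number). -/
def PreparationScheme.complexity {M : ℕ} (D : PreparationScheme M) (ε : ℝ)
    (ψ : QubitSpace M) : ℕ∞ :=
  ⨅ (p : List Bool) (_ : D.Prepares ε p ψ), (p.length : ℕ∞)

/-- `K` is a notion of quantum Kolmogorov complexity, of precision `ε`, for pure states of `M`
qubits which counts classical bits: for some preparation scheme, `K ψ` bits contain all that is
needed to prepare a state `ε`-close to `ψ`. The minimal such number, `K = D.complexity ε`, is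
included; a value `⊤` is allowed for states without a description. -/
def CountsPreparationBits {M : ℕ} (ε : ℝ) (K : QubitSpace M → ℕ∞) : Prop :=
  ∃ D : PreparationScheme M, ∀ ψ : QubitSpace M, ‖ψ‖ = 1 → D.complexity ε ψ ≤ K ψ

/-- Distinct inputs have code words at Hamming distance at least `(1 - Δ) m`. -/
def IsCode {n m : ℕ} (Δ : ℝ) (E : (Fin n → Bool) → (Fin m → Bool)) : Prop :=
  ∀ x y : Fin n → Bool, x ≠ y → (1 - Δ) * (m : ℝ) ≤ (hammingDist (E x) (E y) : ℝ)

/-- The basis label of `|i⟩|b⟩`: the first `k` qubits hold the binary digits of `i` (which must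
be less than `2 ^ k`), the last one holds `b`. -/
def ketLabel (k i : ℕ) (b : Bool) : Fin (k + 1) → Bool :=
  Fin.snoc (α := fun _ => Bool) (fun j : Fin k => i.testBit (j : ℕ)) b

/-- The number of qubits of a fingerprint for words of length `m`: `⌈log₂ m⌉ + 1`. -/
abbrev fingerprintQubits (m : ℕ) : ℕ := Nat.clog 2 m + 1

/-- The fingerprint `|h_x⟩ = m^(-1/2) ∑ i, |i⟩|E_i(x)⟩`. -/
def fingerprint {n m : ℕ} (E : (Fin n → Bool) → (Fin m → Bool)) (x : Fin n → Bool) :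
    QubitSpace (fingerprintQubits m) :=
  ((1 / Real.sqrt m : ℝ) : ℂ) •
    ∑ i : Fin m, EuclideanSpace.single (ketLabel (Nat.clog 2 m) (i : ℕ) (E x i)) (1 : ℂ)

end

/-!
The lower bounds count bit strings. Let `v i` be unit vectors with pairwise overlaps of modulus at
most `δ < 1 - ε`. Since `⟨ψ|ρ|ψ⟩` is a sum of squared overlaps of `ψ` with vectors whose squared
norms add up to `tr ρ = 1`, a Bessel inequality for almost orthogonal vectors
(`sum_norm_inner_sq_le`) shows that one mixed state `ρ` can be `ε`-close to at most
`(1 - δ) / (1 - ε - δ)` of the `v i` (`DensityState.card_mul_le_of_le_fidelity`). This number does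
not depend on the dimension, so among `2 ^ n` such vectors one has complexity at least
`n - O(1)` (`exists_le_of_countsPreparationBits`).

Fingerprints of a `Δ`-code have overlaps `1 - dist / m ∈ [0, Δ]`, so one of them has complexity at
least `n - O(1)`, while `2 ^ (M / 2) / c ≤ 2 √(n / c) ≤ 2 n`. For arbitrary precision `ε < 1` the
states with amplitudes `± 2 ^ (-M / 2)` replace the fingerprints: their overlaps are
`1 - 2 dist / 2 ^ M`, and these are small if the distances of the sign patterns are close to
`2 ^ M / 2`. There are even `2 ^ (const * 2 ^ M)` such patterns.

Both kinds of codes come from the greedy (Gilbert-Varshamov) argument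
(`exists_family_pairwise_not`) and the Chernoff bound for the volume of a Hamming ball
(`card_hammingDist_lt_le`).
-/

/-! ### States close to many almost orthogonal vectors -/

open Finset in
/-- A Bessel inequality for almost orthogonal unit vectors. With `w = ∑ i, ⟨v i, b⟩ v i` and
`S = ∑ i, |⟨v i, b⟩|²` one has `S = ⟨w, b⟩ ≤ ‖w‖ ‖b‖`, and expanding `‖w‖²` bounds it by a multiple
of `S`. -/
theorem sum_norm_inner_sq_le {H ι : Type*} [NormedAddCommGroup H] [InnerProductSpace ℂ H]
    (s : Finset ι) (v : ι → H) (b : H) {δ : ℝ} (hδ : 0 ≤ δ) (hδ1 : δ ≤ 1)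
    (hv : ∀ i ∈ s, ‖v i‖ = 1)
    (hvv : ∀ i ∈ s, ∀ j ∈ s, i ≠ j → ‖inner ℂ (v i) (v j)‖ ≤ δ) :
    ∑ i ∈ s, ‖inner ℂ (v i) b‖ ^ 2 ≤ (1 - δ + #s * δ) * ‖b‖ ^ 2 := by
  classical
  set a : ι → ℂ := fun i => inner ℂ (v i) b with ha
  set S : ℝ := ∑ i ∈ s, ‖a i‖ ^ 2 with hS
  set w : H := ∑ i ∈ s, a i • v i with hw
  set A : ℝ := ∑ i ∈ s, ‖a i‖ with hA
  have hS0 : 0 ≤ S := sum_nonneg fun _ _ => by positivity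
  have hwb : inner ℂ w b = (S : ℂ) := by
    rw [hw, sum_inner, hS]
    push_cast
    refine sum_congr rfl fun i _ => ?_
    rw [inner_smul_left, RCLike.conj_mul]
    rfl
  have h1 : S ≤ ‖w‖ * ‖b‖ := by
    have := norm_inner_le_norm (𝕜 := ℂ) w b
    rwa [hwb, Complex.norm_real, Real.norm_of_nonneg hS0] at this
  have hww : ‖w‖ ^ 2 ≤ (1 - δ) * S + δ * A ^ 2 := by
    have e1 : inner ℂ w w = ∑ i ∈ s, ∑ j ∈ s, (starRingEnd ℂ) (a i) * (a j * inner ℂ (v i) (v j)) := by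
      rw [hw, sum_inner]
      refine sum_congr rfl fun i _ => ?_
      rw [inner_sum]
      refine sum_congr rfl fun j _ => ?_
      rw [inner_smul_left, inner_smul_right]
    have e2 : ‖w‖ ^ 2 = ‖inner ℂ w w‖ := by
      rw [inner_self_eq_norm_sq_to_K]; simp
    rw [e2, e1]
    calc _ ≤ ∑ i ∈ s, ∑ j ∈ s, ‖a i‖ * (‖a j‖ * ‖inner ℂ (v i) (v j)‖) := by
          refine (norm_sum_le _ _).trans (sum_le_sum fun i _ => (norm_sum_le _ _).trans ?_)
          simp
      _ ≤ ∑ i ∈ s, ∑ j ∈ s, (δ * (‖a i‖ * ‖a j‖) + if i = j then (1 - δ) * ‖a i‖ ^ 2 else 0) := by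
          refine sum_le_sum fun i hi => sum_le_sum fun j hj => ?_
          split_ifs with hij
          · subst hij
            rw [inner_self_eq_norm_sq_to_K, hv i hi]
            simp only [RCLike.ofReal_one, one_pow, norm_one]
            exact le_of_eq (by ring)
          · have := mul_le_mul_of_nonneg_left (hvv i hi j hj hij)
              (mul_nonneg (norm_nonneg (a i)) (norm_nonneg (a j)))
            linarith
      _ = (1 - δ) * S + δ * A ^ 2 := by
          simp_rw [sum_add_distrib, ← mul_sum, sum_ite_eq]
          rw [← sum_mul, sum_ite_mem, inter_self, ← mul_sum, hA, hS]
          ring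
  have hAS : A ^ 2 ≤ #s * S := sq_sum_le_card_mul_sum_sq
  have hb : S * S ≤ ((1 - δ + #s * δ) * ‖b‖ ^ 2) * S := by
    calc S * S ≤ (‖w‖ * ‖b‖) * (‖w‖ * ‖b‖) := mul_self_le_mul_self hS0 h1
      _ = ‖w‖ ^ 2 * ‖b‖ ^ 2 := by ring
      _ ≤ ((1 - δ + #s * δ) * S) * ‖b‖ ^ 2 := by
          gcongr
          nlinarith
      _ = _ := by ring
  rcases hS0.eq_or_lt with h | h
  · rw [← h]
    have : 0 ≤ 1 - δ := by linarith
    positivity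
  · exact le_of_mul_le_mul_right hb h

/-- With a factorization `ρ = Bᴴ B`, the fidelity is the sum of the squared overlaps with the
(conjugated) rows of `B`, and the squared norms of these rows add up to `tr ρ = 1`. -/
theorem DensityState.exists_fidelity_eq_sum {M : ℕ} (ρ : DensityState M) :
    ∃ b : (Fin M → Bool) → QubitSpace M, ∑ k, ‖b k‖ ^ 2 = 1 ∧
      ∀ ψ, ρ.fidelity ψ = ∑ k, ‖inner ℂ ψ (b k)‖ ^ 2 := by
  obtain ⟨B, hB⟩ : ∃ B, ρ.mat = B.conjTranspose * B := by
    open scoped MatrixOrder in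
    exact CStarAlgebra.nonneg_iff_eq_star_mul_self.1 ρ.posSemidef.nonneg
  refine ⟨fun k => WithLp.toLp 2 fun l => star (B k l), ?_, fun ψ => ?_⟩
  · have h := congrArg Complex.re ρ.trace_eq_one
    rw [hB, Matrix.trace] at h
    simp only [Matrix.diag_apply, Matrix.mul_apply, Matrix.conjTranspose_apply, Complex.re_sum,
      Complex.one_re] at h
    rw [← h, Finset.sum_comm]
    refine Finset.sum_congr rfl fun k _ => ?_
    rw [EuclideanSpace.norm_sq_eq]
    refine Finset.sum_congr rfl fun l _ => ?_
    simp only [norm_star]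
    rw [← Complex.normSq_eq_norm_sq]
    simp [Complex.normSq_apply]
  · rw [DensityState.fidelity, hB, ← Matrix.mulVec_mulVec, Matrix.dotProduct_mulVec,
      ← Matrix.star_mulVec, dotProduct, Complex.re_sum]
    refine Finset.sum_congr rfl fun k _ => ?_
    rw [norm_inner_symm, ← Complex.normSq_eq_norm_sq]
    have : inner ℂ (WithLp.toLp 2 fun l => star (B k l)) ψ = B.mulVec ψ.ofLp k := by
      simp [PiLp.inner_apply, Matrix.mulVec, dotProduct, mul_comm]
    rw [this]
    simp [Complex.normSq_apply]

open Finset in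
/-- One mixed state is close to boundedly many of the almost orthogonal unit vectors: sum the
Bessel inequality over the rows of a factorization of the density matrix. -/
theorem DensityState.card_mul_le_of_le_fidelity {M : ℕ} {ι : Type*} (ρ : DensityState M)
    (s : Finset ι) (v : ι → QubitSpace M) {δ ε : ℝ} (hδ : 0 ≤ δ) (hδ1 : δ ≤ 1)
    (hv : ∀ i ∈ s, ‖v i‖ = 1) (hvv : ∀ i ∈ s, ∀ j ∈ s, i ≠ j → ‖inner ℂ (v i) (v j)‖ ≤ δ)
    (hρ : ∀ i ∈ s, 1 - ε ≤ ρ.fidelity (v i)) : #s * (1 - ε - δ) ≤ 1 - δ := by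
  obtain ⟨b, hb, hf⟩ := ρ.exists_fidelity_eq_sum
  have h1 : #s * (1 - ε) ≤ ∑ i ∈ s, ρ.fidelity (v i) := by
    rw [← nsmul_eq_mul]
    exact card_nsmul_le_sum _ _ _ hρ
  have h2 : ∑ i ∈ s, ρ.fidelity (v i) ≤ 1 - δ + #s * δ := by
    simp_rw [hf]
    rw [sum_comm]
    refine (sum_le_sum fun k _ => sum_norm_inner_sq_le s v (b k) hδ hδ1 hv hvv).trans ?_
    rw [← mul_sum, hb, mul_one]
  linarith

/-! ### Counting descriptions -/

/-- There are fewer than `2 ^ k` bit strings of length less than `k`. -/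
theorem exists_finset_list_length_lt (k : ℕ) :
    ∃ P : Finset (List Bool), P.card ≤ 2 ^ k ∧ ∀ p : List Bool, p.length < k → p ∈ P := by
  refine ⟨(Finset.range k).biUnion fun j =>
    (Finset.univ : Finset (List.Vector Bool j)).image List.Vector.toList, ?_, fun p hp => ?_⟩
  · refine Finset.card_biUnion_le.trans ?_
    calc _ ≤ ∑ j ∈ Finset.range k, 2 ^ j := Finset.sum_le_sum fun j _ =>
          Finset.card_image_le.trans (by rw [Finset.card_univ, card_vector, Fintype.card_bool])
      _ ≤ 2 ^ k := by
          have := Nat.geomSum_lt (m := 2) (n := k) (s := Finset.range k) le_rfl (by simp)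
          exact this.le
  · exact Finset.mem_biUnion.2 ⟨p.length, Finset.mem_range.2 hp,
      Finset.mem_image.2 ⟨⟨p, rfl⟩, Finset.mem_univ _, rfl⟩⟩

/-- Almost orthogonal states cannot all have short descriptions: each of the at most `2 ^ k`
strings of length less than `k` describes at most `2 ^ l` of them. -/
theorem exists_le_of_countsPreparationBits {M : ℕ} {ι : Type*} [Fintype ι]
    (v : ι → QubitSpace M) {δ ε : ℝ} {k l : ℕ} (hδ : 0 ≤ δ) (hδ1 : δ ≤ 1)
    (hv : ∀ i, ‖v i‖ = 1) (hvv : ∀ i j, i ≠ j → ‖inner ℂ (v i) (v j)‖ ≤ δ) (hεδ : 0 < 1 - ε - δ)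
    (hl : 1 - δ < 2 ^ l * (1 - ε - δ)) (hk : 2 ^ (k + l) ≤ Fintype.card ι)
    {K : QubitSpace M → ℕ∞} (hK : CountsPreparationBits ε K) : ∃ i, (k : ℕ∞) ≤ K (v i) := by
  classical
  obtain ⟨D, hD⟩ := hK
  by_contra! hcon
  have hp : ∀ i, ∃ p : List Bool, p.length < k ∧ D.Prepares ε p (v i) := by
    intro i
    have h := (hD _ (hv i)).trans_lt (hcon i)
    simp only [PreparationScheme.complexity, iInf_lt_iff] at h
    obtain ⟨p, hp, hlt⟩ := h
    exact ⟨p, by exact_mod_cast hlt, hp⟩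
  choose p hpk hp using hp
  obtain ⟨P, hPc, hP⟩ := exists_finset_list_length_lt k
  -- The strings `p i` may coincide, but only for boundedly many `i`.
  have hfib : ∀ q ∈ P, (Finset.univ.filter fun i => p i = q).card < 2 ^ l := by
    intro q _
    rcases (Finset.univ.filter fun i => p i = q).eq_empty_or_nonempty with h0 | ⟨i₀, hi₀⟩
    · rw [h0]; simp
    · obtain ⟨ρ, hρ, -⟩ := hp i₀
      have := ρ.card_mul_le_of_le_fidelity (ε := ε) (Finset.univ.filter fun i => p i = q) v hδ hδ1
        (fun i _ => hv i) (fun i _ j _ => hvv i j) (fun i hi => by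
          obtain ⟨ρ', hρ', hf⟩ := hp i
          rw [(Finset.mem_filter.1 hi).2, ← (Finset.mem_filter.1 hi₀).2, hρ] at hρ'
          cases hρ'
          exact hf)
      have := lt_of_mul_lt_mul_right (this.trans_lt hl) hεδ.le
      exact_mod_cast this
  have hP0 : P.Nonempty := by
    have : 0 < Fintype.card ι := lt_of_lt_of_le (by positivity) hk
    obtain ⟨i⟩ := Fintype.card_pos_iff.1 this
    exact ⟨_, hP _ (hpk i)⟩
  have : Fintype.card ι < 2 ^ (k + l) := by
    calc Fintype.card ι = ∑ q ∈ P, (Finset.univ.filter fun i => p i = q).card :=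
          Finset.card_eq_sum_card_fiberwise fun i _ => hP _ (hpk i)
      _ < ∑ q ∈ P, 2 ^ l := Finset.sum_lt_sum_of_nonempty hP0 hfib
      _ ≤ 2 ^ (k + l) := by
          rw [Finset.sum_const, smul_eq_mul, pow_add]
          gcongr
  omega

/-! ### Codes -/

open Finset in
/-- The Chernoff bound for the volume of a Hamming ball of radius `(1/2 - η) |J|`. -/
theorem card_hammingDist_lt_le {J : Type*} [Fintype J] [DecidableEq J] (x : J → Bool) {η : ℝ}
    (hη : 0 ≤ η) :
    (#{y | (hammingDist x y : ℝ) < (1 / 2 - η) * Fintype.card J} : ℝ) ≤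
      2 ^ Fintype.card J * Real.exp (-(2 * η ^ 2 * Fintype.card J)) := by
  set d := Fintype.card J with hd
  -- The exponent `4 η` is the optimal one for the bound `cosh t ≤ exp (t ^ 2 / 2)`.
  have hgen : ∑ y : J → Bool, Real.exp (-(4 * η) * hammingDist x y) =
      (1 + Real.exp (-(4 * η))) ^ d := by
    have h1 : ∀ y : J → Bool, Real.exp (-(4 * η) * hammingDist x y) =
        ∏ i, if x i = y i then 1 else Real.exp (-(4 * η)) := by
      intro y
      rw [prod_ite, prod_const_one, one_mul, prod_const, ← Real.exp_nat_mul, hammingDist, mul_comm]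
    simp_rw [h1]
    rw [← Fintype.piFinset_univ,
      ← prod_univ_sum (fun _ => univ) fun i b => if x i = b then 1 else Real.exp (-(4 * η))]
    rw [hd, ← card_univ, ← prod_const]
    refine prod_congr rfl fun i _ => ?_
    cases x i <;> simp [add_comm]
  have hcosh : 1 + Real.exp (-(4 * η)) ≤ 2 * Real.exp (2 * η ^ 2 - 2 * η) := by
    have h := Real.cosh_le_exp_half_sq (2 * η)
    rw [Real.cosh_eq] at h
    calc 1 + Real.exp (-(4 * η))
        = 2 * (((Real.exp (2 * η) + Real.exp (-(2 * η))) / 2) * Real.exp (-(2 * η))) := by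
          rw [div_mul_eq_mul_div, mul_div_cancel₀ _ (two_ne_zero' ℝ), add_mul, ← Real.exp_add,
            ← Real.exp_add]
          congr 1
          · rw [← Real.exp_zero]; congr 1; ring
          · congr 1; ring
      _ ≤ 2 * (Real.exp ((2 * η) ^ 2 / 2) * Real.exp (-(2 * η))) := by gcongr
      _ = _ := by rw [← Real.exp_add]; congr 2; ring
  -- Markov's inequality for `exp (-4 η dist)`.
  have hmarkov : (#{y | (hammingDist x y : ℝ) < (1 / 2 - η) * d} : ℝ) *
      Real.exp (-(4 * η) * ((1 / 2 - η) * d)) ≤ (1 + Real.exp (-(4 * η))) ^ d := by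
    rw [← hgen, ← nsmul_eq_mul]
    refine (card_nsmul_le_sum _ _ _ fun y hy => ?_).trans
      (sum_le_sum_of_subset_of_nonneg (filter_subset _ _) fun _ _ _ => (Real.exp_pos _).le)
    have := (mem_filter.1 hy).2.le
    exact Real.exp_le_exp.2 (mul_le_mul_of_nonpos_left this (by linarith))
  refine le_of_mul_le_mul_right (hmarkov.trans ?_) (Real.exp_pos (-(4 * η) * ((1 / 2 - η) * d)))
  refine (pow_le_pow_left₀ (by positivity) hcosh d).trans (le_of_eq ?_)
  rw [mul_pow, ← Real.exp_nat_mul, mul_assoc, ← Real.exp_add]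
  congr 2
  ring

open Finset in
/-- The greedy (Gilbert-Varshamov) choice of `N` points no two of which are related. -/
theorem exists_list_pairwise_not {Y : Type*} [Fintype Y] (R : Y → Y → Prop) [DecidableRel R]
    {V : ℝ} (hV : 0 < V) (hR : ∀ x, (#{y | R x y} : ℝ) ≤ V) (N : ℕ)
    (hN : N * V ≤ Fintype.card Y) : ∃ L : List Y, L.length = N ∧ L.Pairwise fun x y => ¬ R y x := by
  classical
  induction N with
  | zero => exact ⟨[], rfl, List.Pairwise.nil⟩
  | succ N ih =>
    push_cast at hN
    obtain ⟨L, hL, hp⟩ := ih (by linarith)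
    suffices ∃ y, ∀ x ∈ L, ¬ R x y by
      obtain ⟨y, hy⟩ := this
      exact ⟨y :: L, by simp [hL], List.pairwise_cons.2 ⟨hy, hp⟩⟩
    by_contra! hcon
    have h1 : (Fintype.card Y : ℝ) ≤ N * V := by
      calc (Fintype.card Y : ℝ) ≤ #(L.toFinset.biUnion fun x => {y | R x y}) := by
            rw [← card_univ]
            exact_mod_cast card_le_card fun y _ => by simpa using hcon y
        _ ≤ ∑ x ∈ L.toFinset, (#{y | R x y} : ℝ) := by exact_mod_cast card_biUnion_le
        _ ≤ #L.toFinset * V := by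
            rw [← nsmul_eq_mul]
            exact sum_le_card_nsmul _ _ _ fun x _ => hR x
        _ ≤ N * V := by
            gcongr
            exact (List.toFinset_card_le L).trans_eq hL
    linarith

open Finset in
/-- The greedy choice, indexed by any finite type `ι`. As `R` need not be reflexive, `E` need not be
injective. -/
theorem exists_family_pairwise_not {ι Y : Type*} [Fintype ι] [Fintype Y] (R : Y → Y → Prop)
    [DecidableRel R] (hsymm : ∀ x y, R x y → R y x) {V : ℝ} (hV : 0 < V)
    (hR : ∀ x, (#{y | R x y} : ℝ) ≤ V) (hN : Fintype.card ι * V ≤ Fintype.card Y) :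
    ∃ E : ι → Y, ∀ i j, i ≠ j → ¬ R (E i) (E j) := by
  obtain ⟨L, hL, hp⟩ := exists_list_pairwise_not R hV hR _ hN
  have e : ι ≃ Fin L.length := Fintype.equivFinOfCardEq hL.symm
  rw [List.pairwise_iff_get] at hp
  refine ⟨fun i => L.get (e i), fun i j hij h => ?_⟩
  rcases lt_or_gt_of_ne (e.injective.ne hij) with hlt | hlt
  · exact hp _ _ hlt (hsymm _ _ h)
  · exact hp _ _ hlt h

theorem two_pow_le_exp {n : ℕ} {a : ℝ} (h : n ≤ a) : (2 : ℝ) ^ n ≤ Real.exp a := by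
  have h2 : (2 : ℝ) ≤ Real.exp 1 := by linarith [Real.add_one_le_exp (1 : ℝ)]
  calc (2 : ℝ) ^ n ≤ Real.exp 1 ^ n := by gcongr
    _ = Real.exp n := by rw [← Real.exp_nat_mul, mul_one]
    _ ≤ _ := Real.exp_le_exp.2 h

/-- The rate of the code is the Chernoff exponent `2 (Δ - 1/2)²` of balls of radius
`(1 - Δ) m = (1/2 - (Δ - 1/2)) m`. -/
theorem exists_isCode {Δ : ℝ} (hΔ : 1 / 2 < Δ) {n m : ℕ}
    (h : n ≤ 2 * (Δ - 1 / 2) ^ 2 * m) :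
    ∃ E : (Fin n → Bool) → (Fin m → Bool), IsCode Δ E := by
  classical
  obtain ⟨E, hE⟩ := exists_family_pairwise_not (ι := Fin n → Bool)
    (fun x y : Fin m → Bool => (hammingDist x y : ℝ) < (1 / 2 - (Δ - 1 / 2)) * Fintype.card (Fin m))
    (fun x y hxy => by rwa [hammingDist_comm]) (by positivity)
    (fun x => card_hammingDist_lt_le x (by linarith)) (by
      simp only [Fintype.card_pi, Fintype.card_bool, Finset.prod_const, Finset.card_univ,
        Fintype.card_fin]
      push_cast
      calc (2 : ℝ) ^ n * (2 ^ m * Real.exp (-(2 * (Δ - 1 / 2) ^ 2 * m)))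
          ≤ Real.exp (2 * (Δ - 1 / 2) ^ 2 * m) *
            (2 ^ m * Real.exp (-(2 * (Δ - 1 / 2) ^ 2 * m))) := by
            gcongr
            exact two_pow_le_exp h
        _ = 2 ^ m := by
            rw [mul_left_comm, ← Real.exp_add, add_neg_cancel, Real.exp_zero, mul_one])
  refine ⟨E, fun x y hxy => ?_⟩
  have := not_lt.1 (hE x y hxy)
  rw [Fintype.card_fin] at this
  linarith

open Finset in
/-- There are exponentially many words whose pairwise distances are all close to `|J| / 2`.
A word is too far from `x` exactly if its complement is too close to `x`. -/
theorem exists_family_hammingDist_near_half (n : ℕ) {J : Type*} [Fintype J] [DecidableEq J]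
    {η : ℝ} (hη : 0 ≤ η) (h : (n + 1 : ℕ) ≤ 2 * η ^ 2 * Fintype.card J) :
    ∃ E : (Fin n → Bool) → (J → Bool), ∀ x y, x ≠ y →
      |1 / 2 * (Fintype.card J : ℝ) - hammingDist (E x) (E y)| ≤ η * Fintype.card J := by
  classical
  have hcompl : ∀ x y : J → Bool,
      (hammingDist x (fun i => !y i) : ℝ) = Fintype.card J - hammingDist x y := by
    intro x y
    have := card_filter_add_card_filter_not (s := (univ : Finset J)) (fun i => x i ≠ y i)
    have h2 : #{i | ¬ (x i ≠ y i)} = hammingDist x (fun i => !y i) := by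
      unfold hammingDist
      congr 1
      ext i
      cases x i <;> cases y i <;> simp
    rw [h2, card_univ] at this
    rw [← this]
    unfold hammingDist
    push_cast
    ring
  set d := Fintype.card J with hd
  obtain ⟨E, hE⟩ := exists_family_pairwise_not (ι := Fin n → Bool)
    (fun x y : J → Bool => (hammingDist x y : ℝ) < (1 / 2 - η) * d ∨
      (hammingDist x (fun i => !y i) : ℝ) < (1 / 2 - η) * d)
    (V := 2 * (2 ^ d * Real.exp (-(2 * η ^ 2 * d))))
    (fun x y hxy => by simpa only [hcompl, hammingDist_comm x y] using hxy) (by positivity)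
    (fun x => by
      have h1 := card_hammingDist_lt_le x hη
      have h2 : #{y : J → Bool | (hammingDist x (fun i => !y i) : ℝ) < (1 / 2 - η) * d} ≤
          #{y | (hammingDist x y : ℝ) < (1 / 2 - η) * d} := by
        refine card_le_card_of_injOn (fun y i => !y i) (fun y hy => by simpa using hy) ?_
        intro y _ z _ hyz
        funext i
        simpa using congrFun hyz i
      have h3 : (#{y : J → Bool | (hammingDist x y : ℝ) < (1 / 2 - η) * d ∨
          (hammingDist x (fun i => !y i) : ℝ) < (1 / 2 - η) * d} : ℝ) ≤
          #{y | (hammingDist x y : ℝ) < (1 / 2 - η) * d} +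
          #{y : J → Bool | (hammingDist x (fun i => !y i) : ℝ) < (1 / 2 - η) * d} := by
        rw [filter_or]
        exact_mod_cast card_union_le _ _
      have h2' : (#{y : J → Bool | (hammingDist x (fun i => !y i) : ℝ) < (1 / 2 - η) * d} : ℝ) ≤
          #{y | (hammingDist x y : ℝ) < (1 / 2 - η) * d} := by exact_mod_cast h2
      linarith) (by
      simp only [Fintype.card_pi, Fintype.card_bool, prod_const, card_univ, Fintype.card_fin]
      rw [← hd]
      push_cast
      calc (2 : ℝ) ^ n * (2 * (2 ^ d * Real.exp (-(2 * η ^ 2 * d))))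
          = 2 ^ (n + 1) * (2 ^ d * Real.exp (-(2 * η ^ 2 * d))) := by ring
        _ ≤ Real.exp (2 * η ^ 2 * d) * (2 ^ d * Real.exp (-(2 * η ^ 2 * d))) := by
            gcongr
            exact two_pow_le_exp h
        _ = 2 ^ d := by
            rw [mul_left_comm, ← Real.exp_add, add_neg_cancel, Real.exp_zero, mul_one])
  refine ⟨E, fun x y hxy => ?_⟩
  have := hE x y hxy
  simp only [hcompl, not_or, not_lt] at this
  rw [abs_le]
  constructor <;> linarith

/-! ### Fingerprints and sign states -/

theorem ketLabel_eq_iff {k i j : ℕ} (hi : i < 2 ^ k) (hj : j < 2 ^ k) (a b : Bool) :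
    ketLabel k i a = ketLabel k j b ↔ i = j ∧ a = b := by
  refine ⟨fun h => ?_, fun h => by rw [h.1, h.2]⟩
  obtain ⟨h1, h2⟩ := Fin.snoc_injective2 h
  refine ⟨Nat.eq_of_testBit_eq fun l => ?_, h2⟩
  by_cases hl : l < k
  · exact congrFun h1 ⟨l, hl⟩
  · have : 2 ^ k ≤ 2 ^ l := Nat.pow_le_pow_right (by norm_num) (not_lt.1 hl)
    rw [Nat.testBit_eq_false_of_lt (hi.trans_le this),
      Nat.testBit_eq_false_of_lt (hj.trans_le this)]

open Finset in
/-- The overlap of two fingerprints is the fraction of positions at which the code words agree. -/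
theorem inner_fingerprint {n m : ℕ} (hm : 0 < m) (E : (Fin n → Bool) → (Fin m → Bool))
    (x y : Fin n → Bool) :
    inner ℂ (fingerprint E x) (fingerprint E y) =
      ((1 - hammingDist (E x) (E y) / m : ℝ) : ℂ) := by
  -- Only positions below `2 ^ ⌈log₂ m⌉` are determined by their binary digits.
  have hlt : ∀ i : Fin m, (i : ℕ) < 2 ^ Nat.clog 2 m := fun i =>
    i.2.trans_le (Nat.le_pow_clog (by norm_num) m)
  have h1 : ∀ i j : Fin m,
      inner ℂ (EuclideanSpace.single (ketLabel (Nat.clog 2 m) i (E x i)) (1 : ℂ))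
        (EuclideanSpace.single (ketLabel (Nat.clog 2 m) j (E y j)) (1 : ℂ)) =
      if i = j then (if E x i = E y i then (1 : ℂ) else 0) else 0 := by
    intro i j
    rw [EuclideanSpace.inner_single_left, map_one, one_mul, PiLp.single_apply]
    simp only [ketLabel_eq_iff (hlt i) (hlt j), ← Fin.ext_iff]
    by_cases hij : i = j
    · subst hij; simp
    · simp [hij]
  have h2 : (#{i | E x i = E y i} : ℝ) = m - hammingDist (E x) (E y) := by
    have := card_filter_add_card_filter_not (s := (univ : Finset (Fin m))) (fun i => E x i = E y i)
    rw [card_univ, Fintype.card_fin] at this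
    have h' : (#{i | E x i = E y i} : ℝ) + hammingDist (E x) (E y) = m := by exact_mod_cast this
    linarith
  rw [fingerprint, fingerprint, inner_smul_left, inner_smul_right, sum_inner]
  simp_rw [inner_sum, h1, sum_ite_eq, mem_univ, if_true]
  rw [sum_boole, Complex.conj_ofReal]
  have hm' : (0 : ℝ) < m := by exact_mod_cast hm
  have h3 : (1 / Real.sqrt m) * ((1 / Real.sqrt m) * (#{i | E x i = E y i} : ℝ)) =
      1 - hammingDist (E x) (E y) / m := by
    rw [h2, ← mul_assoc, div_mul_div_comm, Real.mul_self_sqrt hm'.le]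
    field_simp
  rw [← h3]
  push_cast
  rfl

theorem norm_eq_one_of_inner_self {H : Type*} [NormedAddCommGroup H] [InnerProductSpace ℂ H]
    {v : H} (h : inner ℂ v v = (1 : ℂ)) : ‖v‖ = 1 := by
  rw [inner_self_eq_norm_sq_to_K] at h
  have h' : ‖v‖ ^ 2 = 1 := Complex.ofReal_injective (by simpa using h)
  exact (pow_eq_one_iff_of_nonneg (norm_nonneg v) two_ne_zero).1 h'

theorem norm_fingerprint {n m : ℕ} (hm : 0 < m) (E : (Fin n → Bool) → (Fin m → Bool))
    (x : Fin n → Bool) : ‖fingerprint E x‖ = 1 :=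
  norm_eq_one_of_inner_self (by rw [inner_fingerprint hm]; simp)

theorem norm_inner_fingerprint_le {n m : ℕ} {Δ : ℝ} (hm : 0 < m)
    {E : (Fin n → Bool) → (Fin m → Bool)} (hE : IsCode Δ E) {x y : Fin n → Bool} (hxy : x ≠ y) :
    ‖inner ℂ (fingerprint E x) (fingerprint E y)‖ ≤ Δ := by
  have hm' : (0 : ℝ) < m := by exact_mod_cast hm
  have h1 : (hammingDist (E x) (E y) : ℝ) / m ≤ 1 := by
    rw [div_le_one hm']
    exact_mod_cast (hammingDist_le_card_fintype (x := E x) (y := E y)).trans_eq (Fintype.card_fin m)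
  have h2 : 1 - Δ ≤ (hammingDist (E x) (E y) : ℝ) / m := (le_div_iff₀ hm').2 (hE x y hxy)
  rw [inner_fingerprint hm, Complex.norm_real, Real.norm_of_nonneg (by linarith)]
  linarith

/-- The uniform superposition of all basis states, with the signs given by `f`. -/
noncomputable def signState {M : ℕ} (f : (Fin M → Bool) → Bool) : QubitSpace M :=
  WithLp.toLp 2 fun i => ((1 / Real.sqrt (2 ^ M) : ℝ) : ℂ) * if f i then -1 else 1

open Finset in
theorem inner_signState {M : ℕ} (f g : (Fin M → Bool) → Bool) :
    inner ℂ (signState f) (signState g) = ((1 - 2 * hammingDist f g / 2 ^ M : ℝ) : ℂ) := by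
  have h1 : ∀ i, inner ℂ ((signState f).ofLp i) ((signState g).ofLp i) =
      ((1 / 2 ^ M * (1 - 2 * if f i ≠ g i then 1 else 0) : ℝ) : ℂ) := by
    intro i
    have h2 : ((1 / Real.sqrt (2 ^ M) : ℝ) : ℂ) * ((1 / Real.sqrt (2 ^ M) : ℝ) : ℂ) =
        ((1 / 2 ^ M : ℝ) : ℂ) := by
      rw [← Complex.ofReal_mul, div_mul_div_comm, Real.mul_self_sqrt (by positivity), one_mul]
    simp only [signState, RCLike.inner_apply, map_mul, Complex.conj_ofReal]
    rw [mul_mul_mul_comm, h2, Complex.ofReal_mul]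
    congr 1
    cases f i <;> cases g i <;> simp <;> norm_num
  rw [PiLp.inner_apply]
  simp_rw [h1]
  rw [← Complex.ofReal_sum, ← mul_sum, sum_sub_distrib, ← mul_sum, sum_boole]
  congr 1
  simp only [sum_const, card_univ, Fintype.card_pi, Fintype.card_bool, prod_const,
    Fintype.card_fin, nsmul_eq_mul, mul_one]
  unfold hammingDist
  push_cast
  field_simp

theorem two_rpow_half_le (M : ℕ) : (2 : ℝ) ^ ((M : ℝ) / 2) ≤ 2 ^ M := by
  rw [← Real.rpow_natCast]
  refine Real.rpow_le_rpow_of_exponent_le (by norm_num) ?_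
  have : (0 : ℝ) ≤ M := by positivity
  linarith

/-! ### Lower bounds for the complexity -/

/-- Since `2 ^ M ≤ 4 m`, the claimed bound is at most linear in the number of encoded bits. -/
theorem two_rpow_fingerprintQubits_div_le {c : ℝ} {n m : ℕ} (hc : 1 < c) (hn : 0 < n)
    (hm : (m : ℝ) = c * n) :
    (2 : ℝ) ^ ((fingerprintQubits m : ℝ) / 2) / c ≤ 2 * n := by
  have hn' : (1 : ℝ) ≤ n := by exact_mod_cast hn
  have hm1 : 1 < m := by
    have : (1 : ℝ) < m := by rw [hm]; nlinarith
    exact_mod_cast this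
  have h1 : (2 : ℝ) ^ fingerprintQubits m ≤ 4 * m := by
    have := Nat.pow_pred_clog_lt_self (b := 2) (by norm_num) hm1
    have hpos : 0 < Nat.clog 2 m := Nat.clog_pos (by norm_num) hm1
    obtain ⟨k, hk⟩ : ∃ k, Nat.clog 2 m = k + 1 := ⟨_, (Nat.succ_pred_eq_of_pos hpos).symm⟩
    rw [hk] at this
    have h' : (2 : ℝ) ^ k < m := by exact_mod_cast this
    rw [fingerprintQubits, hk, pow_succ, pow_succ]
    linarith
  have h2 : ((2 : ℝ) ^ ((fingerprintQubits m : ℝ) / 2)) ^ 2 = 2 ^ fingerprintQubits m := by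
    rw [← Real.rpow_natCast, ← Real.rpow_mul (by norm_num), ← Real.rpow_natCast]
    congr 1
    push_cast
    ring
  rw [div_le_iff₀ (by linarith)]
  refine le_of_sq_le_sq ?_ (by positivity)
  rw [h2]
  refine h1.trans ?_
  rw [hm]
  have hcn : 1 ≤ c * n := one_le_mul_of_one_le_of_one_le hc.le hn'
  nlinarith [mul_nonneg (zero_le_one.trans hcn) (sub_nonneg.2 hcn)]

theorem ofReal_le_of_natCast_le {a : ℝ} {k : ℕ} {K : ℕ∞} (ha : a ≤ k) (hk : (k : ℕ∞) ≤ K) :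
    ENNReal.ofReal a ≤ (K : ℝ≥0∞) :=
  calc ENNReal.ofReal a ≤ ENNReal.ofReal k := ENNReal.ofReal_le_ofReal ha
    _ = ((k : ℕ∞) : ℝ≥0∞) := by simp
    _ ≤ K := ENat.toENNReal_le.2 hk

theorem exists_two_pow_mul_gt (a : ℝ) {b : ℝ} (hb : 0 < b) : ∃ l : ℕ, a < 2 ^ l * b := by
  obtain ⟨l, hl⟩ := pow_unbounded_of_one_lt (a / b) (one_lt_two (α := ℝ))
  exact ⟨l, (div_lt_iff₀ hb).1 hl⟩

/-- The complexity of some fingerprint is at least `n - l` with `l` depending on `Δ` and `ε` only;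
from `n ≥ 2 l` on this is at least `n / 2`, whence the constant `1 / 4`. -/
theorem fingerprint_complexity_lower_bound {Δ ε : ℝ} (hΔ : 0 < Δ) (hΔ1 : Δ < 1)
    (hεΔ : ε < 1 - Δ) :
    ∃ C : ℝ, 0 < C ∧ ∃ n₀ : ℕ, ∀ (c : ℝ) (n m : ℕ), 1 < c → n₀ ≤ n → (m : ℝ) = c * n →
      ∀ E : (Fin n → Bool) → (Fin m → Bool), IsCode Δ E →
        ∀ K : QubitSpace (fingerprintQubits m) → ℕ∞, CountsPreparationBits ε K →
          ∃ x : Fin n → Bool, ‖fingerprint E x‖ = 1 ∧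
            ENNReal.ofReal (C * ((2 : ℝ) ^ ((fingerprintQubits m : ℝ) / 2) / c))
              ≤ (K (fingerprint E x) : ℝ≥0∞) := by
  have hb : 0 < 1 - ε - Δ := by linarith
  obtain ⟨l, hl⟩ := exists_two_pow_mul_gt (1 - Δ) hb
  refine ⟨1 / 4, by norm_num, 2 * l + 1, fun c n m hc hn hm E hE K hK => ?_⟩
  have hbound := two_rpow_fingerprintQubits_div_le hc (by omega) hm
  have hm0 : 0 < m := by
    have hn' : (0 : ℝ) < n := by exact_mod_cast (by omega : 0 < n)
    have : (0 : ℝ) < m := by rw [hm]; exact mul_pos (by linarith) hn'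
    exact_mod_cast this
  obtain ⟨x, hx⟩ := exists_le_of_countsPreparationBits (k := n - l) (l := l) (fingerprint E) hΔ.le
    hΔ1.le (norm_fingerprint hm0 E) (fun x y => norm_inner_fingerprint_le hm0 hE) hb hl
    (by simp [Nat.sub_add_cancel (by omega : l ≤ n)]) hK
  refine ⟨x, norm_fingerprint hm0 E x, ofReal_le_of_natCast_le ?_ hx⟩
  have h1 : (n : ℝ) ≤ 2 * (n - l : ℕ) := by exact_mod_cast (by omega : n ≤ 2 * (n - l))
  linarith

/-- The sign states of words at pairwise distance near `2 ^ M / 2` are almost orthogonal, and there are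
so many of them that the proof gives complexity at least `η ^ 2 * 2 ^ M`. -/
theorem exists_state_complexity_lower_bound {ε : ℝ} (hε : 0 ≤ ε) (hε1 : ε < 1) :
    ∃ C : ℝ, 0 < C ∧ ∃ M₀ : ℕ, ∀ M : ℕ, M₀ ≤ M →
      ∀ K : QubitSpace M → ℕ∞, CountsPreparationBits ε K →
        ∃ ψ : QubitSpace M, ‖ψ‖ = 1 ∧
          ENNReal.ofReal (C * (2 : ℝ) ^ ((M : ℝ) / 2)) ≤ (K ψ : ℝ≥0∞) := by
  -- The overlaps of the states will be at most `2 * η`, half of the admissible `1 - ε`.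
  set η : ℝ := (1 - ε) / 4 with hη
  have hη0 : 0 < η := by linarith [hη]
  have hb : 0 < 1 - ε - 2 * η := by linarith
  obtain ⟨l, hl⟩ := exists_two_pow_mul_gt (1 - 2 * η) hb
  obtain ⟨M₀, hM₀⟩ := exists_two_pow_mul_gt (l + 2) (pow_pos hη0 2)
  refine ⟨η ^ 2, by positivity, M₀, fun M hM K hK => ?_⟩
  have hM' : (l + 2 : ℝ) < 2 ^ M * η ^ 2 :=
    hM₀.trans_le (by gcongr; norm_num)
  set N : ℕ := ⌊2 * η ^ 2 * 2 ^ M⌋₊ with hN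
  have hN1 : (N : ℝ) ≤ 2 * η ^ 2 * 2 ^ M := Nat.floor_le (by positivity)
  have hN2 : 2 * η ^ 2 * 2 ^ M < N + 1 := Nat.lt_floor_add_one _
  have hlN : l + 2 ≤ N := Nat.le_floor (by push_cast; linarith)
  obtain ⟨k, hk⟩ : ∃ k : ℕ, N = k + l + 1 := ⟨N - l - 1, by omega⟩
  have hcard : (Fintype.card (Fin M → Bool) : ℝ) = 2 ^ M := by simp
  obtain ⟨E, hE⟩ := exists_family_hammingDist_near_half (k + l) (J := Fin M → Bool) hη0.le
    (by rw [hcard, ← hk]; exact hN1)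
  have hnorm : ∀ f : (Fin M → Bool) → Bool, ‖signState f‖ = 1 := fun f =>
    norm_eq_one_of_inner_self (by rw [inner_signState]; simp)
  obtain ⟨x, hx⟩ := exists_le_of_countsPreparationBits (k := k) (l := l) (δ := 2 * η)
    (fun x => signState (E x)) (by positivity) (by linarith) (fun x => hnorm _)
    (fun x y hxy => by
      have h := hE x y hxy
      rw [hcard] at h
      have hd : (0 : ℝ) < 2 ^ M := by positivity
      rw [inner_signState, Complex.norm_real, Real.norm_eq_abs]
      calc |1 - 2 * (hammingDist (E x) (E y) : ℝ) / 2 ^ M|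
          = 2 / 2 ^ M * |1 / 2 * 2 ^ M - (hammingDist (E x) (E y) : ℝ)| := by
            conv_rhs => rw [← abs_of_pos (by positivity : (0 : ℝ) < 2 / 2 ^ M), ← abs_mul]
            congr 1
            field_simp
        _ ≤ 2 / 2 ^ M * (η * 2 ^ M) := by gcongr
        _ = 2 * η := by field_simp)
    hb hl (by simp) hK
  refine ⟨_, hnorm _, ofReal_le_of_natCast_le ?_ hx⟩
  have h1 : (N : ℝ) = k + l + 1 := by exact_mod_cast hk
  have h2 : η ^ 2 * (2 : ℝ) ^ ((M : ℝ) / 2) ≤ η ^ 2 * 2 ^ M :=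
    mul_le_mul_of_nonneg_left (two_rpow_half_le M) (sq_nonneg η)
  linarith

theorem mainTheorem1 :
    -- The lower bound for fingerprints; `C` and `n₀` depend on `Δ` and `ε` only.
    (∀ Δ ε : ℝ, 0 < Δ → Δ < 1 → 0 ≤ ε → ε < 1 - Δ →
      ∃ C : ℝ, 0 < C ∧ ∃ n₀ : ℕ, ∀ (c : ℝ) (n m : ℕ), 1 < c → n₀ ≤ n → (m : ℝ) = c * n →
        ∀ E : (Fin n → Bool) → (Fin m → Bool), IsCode Δ E →
          ∀ K : QubitSpace (fingerprintQubits m) → ℕ∞, CountsPreparationBits ε K →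
            ∃ x : Fin n → Bool, ‖fingerprint E x‖ = 1 ∧
              ENNReal.ofReal (C * ((2 : ℝ) ^ ((fingerprintQubits m : ℝ) / 2) / c))
                ≤ (K (fingerprint E x) : ℝ≥0∞)) ∧
    -- Codes of this kind exist, so the lower bound applies for every large number of qubits.
    (∀ Δ : ℝ, 1 / 2 < Δ → Δ < 1 →
      ∃ c : ℕ, 1 < c ∧ ∀ n : ℕ, ∃ E : (Fin n → Bool) → (Fin (c * n) → Bool), IsCode Δ E) ∧
    -- Some `M`-qubit state has complexity exponential in `M`.
    (∀ ε : ℝ, 0 ≤ ε → ε < 1 →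
      ∃ C : ℝ, 0 < C ∧ ∃ M₀ : ℕ, ∀ M : ℕ, M₀ ≤ M →
        ∀ K : QubitSpace M → ℕ∞, CountsPreparationBits ε K →
          ∃ ψ : QubitSpace M, ‖ψ‖ = 1 ∧
            ENNReal.ofReal (C * (2 : ℝ) ^ ((M : ℝ) / 2)) ≤ (K ψ : ℝ≥0∞)) := by
  refine ⟨fun Δ ε hΔ hΔ1 _ hε => fingerprint_complexity_lower_bound hΔ hΔ1 hε, fun Δ hΔ _ => ?_,
    fun ε hε hε1 => exists_state_complexity_lower_bound hε hε1⟩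
  have hη : 0 < 2 * (Δ - 1 / 2) ^ 2 := by
    have : 0 < Δ - 1 / 2 := by linarith
    positivity
  obtain ⟨c, hc⟩ := exists_nat_gt (1 / (2 * (Δ - 1 / 2) ^ 2))
  refine ⟨c + 2, by omega, fun n => exists_isCode hΔ ?_⟩
  have h1 : 1 ≤ 2 * (Δ - 1 / 2) ^ 2 * c := by
    rw [mul_comm]
    exact ((div_lt_iff₀ hη).1 hc).le
  have hn : (0 : ℝ) ≤ n := by positivity
  push_cast
  nlinarith [mul_nonneg hη.le hn, mul_le_mul_of_nonneg_right h1 hn]
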